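/- Let $\Sigma=\{0,1\}$. A complexity class is any collection of subsets of $\Sigma^*$. A class $\mathcal C$ is closed under disjoint union if $A\oplus B\in\mathcal C$ for all $A,B\in\mathcal C$, where $A\oplus B=\{x0\mid x\in A\}\cup\{x1\mid x\in B\}$. A DPTM is a deterministic oracle Turing machine (here with access to two oracles) whose running time is bounded by a polynomial in the length of the input, the bound being independent of the oracles. For complexity classes $\mathcal C$ and $\mathcal D$, let $\mathrm P^{\mathcal C:\mathcal D}$ be the class of all languages $L\subseteq\Sigma^*$ for which there are $C\in\mathcal C$, $D\in\mathcal D$ and a DPTM $M$ that, with the oracles $C$ and $D$, makes on every input at most one query to $C$ followed by at most one query to $D$, and accepts exactly the strings in $L$. Let $\mathrm P^{\mathcal C,\mathcal D}$ be defined in the same way, except that $M$ makes on every input at most one query to $C$ and at most one query to $D$, in arbitrary (adaptively chosen) order. **Theorem.** If $\mathcal C$ and $\mathcal D$ are complexity classes that are both closed under disjoint union, then $$\mathrm P^{\mathcal C:\mathcal D}=\mathrm P^{\mathcal D:\mathcal C}\ \Longrightarrow\ \mathrm P^{\mathcal C:\mathcal D}=\mathrm P^{\mathcal C,\mathcal D}.$$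 -/

import Mathlib

namespace QueryOrder

/-- What the head on the read-only input tape sees: the left endmarker, an input bit, or the
right endmarker. -/
inductive InSym : Type
  | left
  | bit (b : Bool)
  | right

/-- What a machine with states `Q`, work tapes indexed by `ι` and work alphabet `Γ` does in one
step: an ordinary move, a query to oracle number `o`, or halting.

* `work q inp write dir emit`: go to state `q`, move the input head according to `inp` (`none`
  means stay), write `write i` on work tape `i` and then move its head according to `dir i`,
  and append the bit `emit` (if any) to the write-only query tape.
* `ask o yes no`: ask whether the string on the query tape belongs to oracle number `o`, go to
  state `yes` or `no` according to the answer, and erase the query tape.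
* `halt acc`: halt, accepting iff `acc = true`. -/
inductive Instr (Q ι Γ : Type) : Type
  | work (q : Q) (inp : Option Turing.Dir) (write : ι → Γ) (dir : ι → Option Turing.Dir)
      (emit : Option Bool)
  | ask (o : Fin 2) (yes no : Q)
  | halt (acc : Bool)

/-- Deterministic multi-tape Turing machines with access to two oracles (numbered `0` and `1`):
a read-only input tape with endmarkers, finitely many two-way infinite read-write work tapes
over a finite alphabet whose default element is the blank symbol, and a write-only query
tape. -/
structure OracleTM : Type 1 where
  State : Type
  TapeIdx : Type
  Sym : Type
  [finState : Finite State]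
  [finTapeIdx : Finite TapeIdx]
  [finSym : Finite Sym]
  [blank : Inhabited Sym]
  start : State
  trans : State → InSym → (TapeIdx → Sym) → Instr State TapeIdx Sym

attribute [instance] OracleTM.finState OracleTM.finTapeIdx OracleTM.finSym OracleTM.blank

/-- The symbol in cell `p` of the input tape for input `x`: cell `0` holds the left endmarker,
cells `1, …, |x|` hold `x`, and the next cell holds the right endmarker. -/
def inputAt (x : List Bool) : ℕ → InSym
  | 0 => .left
  | p + 1 => match x[p]? with
    | some b => .bit b
    | none => .right

/-- Moving the input head, which never leaves the cells `0, …, |x| + 1`. -/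
def moveInput (x : List Bool) : Option Turing.Dir → ℕ → ℕ
  | none, p => p
  | some .left, p => p - 1
  | some .right, p => min (p + 1) (x.length + 1)

/-- Moving a work-tape head, or leaving it where it is. -/
def moveTape {Γ : Type} [Inhabited Γ] : Option Turing.Dir → Turing.Tape Γ → Turing.Tape Γ
  | none, T => T
  | some d, T => T.move d

namespace OracleTM

/-- Configurations of `M`. -/
structure Cfg (M : OracleTM) : Type where
  state : M.State
  /-- The position of the head on the input tape. -/
  pos : ℕ
  tapes : M.TapeIdx → Turing.Tape M.Sym
  /-- The string that is currently written on the query tape. -/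
  query : List Bool

variable (M : OracleTM)

/-- The initial configuration: the input head on the left endmarker, blank work tapes, empty
query tape. -/
def init : M.Cfg where
  state := M.start
  pos := 0
  tapes := fun _ => default
  query := []

/-- The instruction that `M` executes next in configuration `c` on input `x`. -/
def instr (x : List Bool) (c : M.Cfg) : Instr M.State M.TapeIdx M.Sym :=
  M.trans c.state (inputAt x c.pos) (fun i => (c.tapes i).head)

open Classical in
/-- One step of `M` on input `x` with the oracles `O 0` and `O 1`; a halted configuration does
not change any more. -/
noncomputable def step (O : Fin 2 → Language Bool) (x : List Bool) (c : M.Cfg) : M.Cfg :=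
  match M.instr x c with
  | .work q inp write dir emit =>
    { state := q
      pos := moveInput x inp c.pos
      tapes := fun i => moveTape (dir i) ((c.tapes i).write (write i))
      query := c.query ++ emit.toList }
  | .ask o yes no =>
    { c with
      state := if c.query ∈ O o then yes else no
      query := [] }
  | .halt _ => c

/-- The configuration of `M` on input `x` with the oracles `O` after `n` steps. -/
noncomputable def run (O : Fin 2 → Language Bool) (x : List Bool) (n : ℕ) : M.Cfg :=
  (M.step O x)^[n] M.init

/-- `M` on input `x` has halted after `n` steps. -/
def HaltsIn (O : Fin 2 → Language Bool) (x : List Bool) (n : ℕ) : Prop :=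
  ∃ acc, M.instr x (M.run O x n) = .halt acc

/-- The number of the oracle that is queried in the next step, if that step is a query. -/
def asked (x : List Bool) (c : M.Cfg) : Option (Fin 2) :=
  match M.instr x c with
  | .ask o _ _ => some o
  | _ => none

/-- The numbers of the oracles that are queried by `M` on input `x` in its first `n` steps, one
entry for each query, in the order of the queries. -/
noncomputable def queries (O : Fin 2 → Language Bool) (x : List Bool) (n : ℕ) : List (Fin 2) :=
  (List.range n).filterMap fun t => M.asked x (M.run O x t)

/-- The language accepted by `M` with the oracles `O`. -/
def accepts (O : Fin 2 → Language Bool) : Language Bool :=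
  {x | ∃ n, M.instr x (M.run O x n) = .halt true}

/-- `M` is a deterministic polynomial-time oracle Turing machine: its running time has a
polynomial bound in the length of the input that does not depend on the oracles. -/
def IsPolyTime : Prop :=
  ∃ p : Polynomial ℕ, ∀ (O : Fin 2 → Language Bool) (x : List Bool),
    M.HaltsIn O x (p.eval x.length)

/-- With the oracles `O`, on every input, `M` makes at most one query to `O 0` followed by at
most one query to `O 1`. -/
def OrderedQueries (O : Fin 2 → Language Bool) : Prop :=
  ∀ x n, (M.queries O x n).Sublist [0, 1]

/-- With the oracles `O`, on every input, `M` makes at most one query to `O 0` and at most one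
query to `O 1`, in arbitrary order. -/
def OnceEachQueries (O : Fin 2 → Language Bool) : Prop :=
  ∀ x n, ∀ o : Fin 2, (M.queries O x n).count o ≤ 1

end OracleTM

/-- The class `P^{C:D}`: polynomial time with at most one query to a set in `C` followed by at
most one query to a set in `D`. -/
def POrdered (C D : Set (Language Bool)) : Set (Language Bool) :=
  {L | ∃ A ∈ C, ∃ B ∈ D, ∃ M : OracleTM, M.IsPolyTime ∧ M.OrderedQueries ![A, B] ∧
    L = M.accepts ![A, B]}

/-- The class `P^{C,D}`: polynomial time with at most one query to a set in `C` and at most one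
query to a set in `D`, in arbitrary order. -/
def PAnyOrder (C D : Set (Language Bool)) : Set (Language Bool) :=
  {L | ∃ A ∈ C, ∃ B ∈ D, ∃ M : OracleTM, M.IsPolyTime ∧ M.OnceEachQueries ![A, B] ∧
    L = M.accepts ![A, B]}

/-- The disjoint union `A ⊕ B = {x0 | x ∈ A} ∪ {x1 | x ∈ B}`. -/
def disjointUnion (A B : Language Bool) : Language Bool :=
  {w | (∃ x ∈ A, w = x ++ [false]) ∨ (∃ x ∈ B, w = x ++ [true])}

/-- `C` is closed under disjoint union. -/
def ClosedUnderDisjointUnion (C : Set (Language Bool)) : Prop :=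
  ∀ A ∈ C, ∀ B ∈ C, disjointUnion A B ∈ C

end QueryOrder

/-!
Up to its first query a machine `M` needs no oracle, so it can be rerun from scratch afterwards by
a machine that already knows which oracle `M` turns to first. On the strings where this is the
second oracle, `M` queries in the order `D`, `C`, so by hypothesis some `M'` decides these strings
with queries in the order `C`, `D`. The machine that runs `M` up to its first query and then starts
over as `M` or as `M'` thus always queries in the order `C`, `D`; disjoint unions let `M` and `M'`
share one oracle from `C` and one from `D`.
-/

namespace QueryOrder

section Tape

variable {Γ Γ' : Type} [Inhabited Γ] [Inhabited Γ']

theorem map_moveTape (f : Turing.PointedMap Γ Γ') (d : Option Turing.Dir) (T : Turing.Tape Γ) :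
    (moveTape d T).map f = moveTape d (T.map f) := by
  cases d with
  | none => rfl
  | some d => exact Turing.Tape.map_move f T d

theorem map_default_tape (f : Turing.PointedMap Γ Γ') :
    (default : Turing.Tape Γ).map f = default :=
  Turing.Tape.map_mk₁ f []

theorem moveTape_none_write_default :
    moveTape none ((default : Turing.Tape Γ).write default) = default :=
  Turing.Tape.write_self default

end Tape

namespace OracleTM

section Run

variable {M : OracleTM} {O : Fin 2 → Language Bool} {x : List Bool}

theorem run_add (m n : ℕ) : M.run O x (m + n) = (M.step O x)^[n] (M.run O x m) := by
  rw [run, run, ← Function.iterate_add_apply, add_comm]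

theorem run_succ (n : ℕ) : M.run O x (n + 1) = M.step O x (M.run O x n) :=
  run_add n 1

theorem step_of_instr_eq_work {c : M.Cfg} {q : M.State} {inp : Option Turing.Dir}
    {w : M.TapeIdx → M.Sym} {d : M.TapeIdx → Option Turing.Dir} {m : Option Bool}
    (h : M.instr x c = .work q inp w d m) :
    M.step O x c = ⟨q, moveInput x inp c.pos, fun i => moveTape (d i) ((c.tapes i).write (w i)),
      c.query ++ m.toList⟩ := by
  simp only [step, h]

open Classical in
theorem step_of_instr_eq_ask {c : M.Cfg} {o : Fin 2} {yes no : M.State}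
    (h : M.instr x c = .ask o yes no) :
    M.step O x c = ⟨if c.query ∈ O o then yes else no, c.pos, c.tapes, []⟩ := by
  simp only [step, h]

theorem step_of_instr_eq_halt {c : M.Cfg} {acc : Bool} (h : M.instr x c = .halt acc) :
    M.step O x c = c := by
  simp only [step, h]

theorem run_eq_of_le {m n : ℕ} {acc : Bool} (h : M.instr x (M.run O x m) = .halt acc)
    (hmn : m ≤ n) : M.run O x n = M.run O x m := by
  obtain ⟨k, rfl⟩ := Nat.exists_eq_add_of_le hmn
  rw [run_add, Function.iterate_fixed (step_of_instr_eq_halt h)]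

theorem HaltsIn.mono {m n : ℕ} (h : M.HaltsIn O x m) (hmn : m ≤ n) : M.HaltsIn O x n := by
  obtain ⟨acc, hacc⟩ := h
  exact ⟨acc, by rw [run_eq_of_le hacc hmn, hacc]⟩

theorem HaltsIn.lt_of_asked_eq_some {m n : ℕ} {o : Fin 2} (hn : M.HaltsIn O x n)
    (ho : M.asked x (M.run O x m) = some o) : m < n := by
  by_contra! hnm
  obtain ⟨acc, hacc⟩ := hn.mono hnm
  simp [asked, hacc] at ho

theorem pos_run_le (n : ℕ) : (M.run O x n).pos ≤ x.length + 1 := by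
  induction n with
  | zero => exact Nat.zero_le _
  | succ n ih =>
    rw [run_succ, step]
    split
    · next inp _ _ _ _ =>
      rcases inp with _ | (_ | _) <;> simp only [moveInput] <;> omega
    · exact ih
    · exact ih

end Run

section Queries

variable (M : OracleTM) (O : Fin 2 → Language Bool) (x : List Bool)

/-- The numbers of the oracles that are queried in the `n` steps that follow configuration `c`. -/
noncomputable def queriesFrom (c : M.Cfg) (n : ℕ) : List (Fin 2) :=
  (List.range n).filterMap fun t => M.asked x ((M.step O x)^[t] c)

/-- The first query of `M` goes to oracle number `o`. -/
def FirstQueryTo (o : Fin 2) : Prop :=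
  ∃ t, M.queries O x t = [] ∧ M.asked x (M.run O x t) = some o

variable {M O x}

theorem queriesFrom_add (c : M.Cfg) (m n : ℕ) :
    M.queriesFrom O x c (m + n) =
      M.queriesFrom O x c m ++ M.queriesFrom O x ((M.step O x)^[m] c) n := by
  simp only [queriesFrom, List.range_add, List.filterMap_append, List.filterMap_map,
    Function.comp_def, ← Function.iterate_add_apply, add_comm _ m]

theorem queries_add (m n : ℕ) :
    M.queries O x (m + n) = M.queries O x m ++ M.queriesFrom O x (M.run O x m) n :=
  queriesFrom_add M.init m n

theorem queriesFrom_one (c : M.Cfg) : M.queriesFrom O x c 1 = (M.asked x c).toList := by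
  cases h : M.asked x c <;> simp [queriesFrom, h]

theorem queries_succ (n : ℕ) :
    M.queries O x (n + 1) = M.queries O x n ++ (M.asked x (M.run O x n)).toList := by
  rw [queries_add, queriesFrom_one]

theorem queries_prefix_of_le {m n : ℕ} (h : m ≤ n) : M.queries O x m <+: M.queries O x n := by
  obtain ⟨k, rfl⟩ := Nat.exists_eq_add_of_le h
  exact ⟨_, (queries_add m k).symm⟩

theorem asked_eq_none_of_queries_eq_nil (h : ∀ n, M.queries O x n = []) (n : ℕ) :
    M.asked x (M.run O x n) = none := by
  simpa [queries_succ, h n] using h (n + 1)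

theorem queries_eq_nil_or_firstQueryTo :
    (∀ n, M.queries O x n = []) ∨ ∃ o, M.FirstQueryTo O x o := by
  by_contra! h
  obtain ⟨⟨n, hn⟩, hfirst⟩ := h
  refine hn ?_
  clear hn
  induction n with
  | zero => rfl
  | succ n ih =>
    cases ho : M.asked x (M.run O x n) with
    | none => rw [queries_succ, ih, ho]; rfl
    | some o => exact absurd ⟨n, ih, ho⟩ (hfirst o)

theorem FirstQueryTo.queries_eq_nil_or_cons {o : Fin 2} (h : M.FirstQueryTo O x o) (n : ℕ) :
    M.queries O x n = [] ∨ ∃ l, M.queries O x n = o :: l := by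
  obtain ⟨t, hnil, ho⟩ := h
  rcases le_or_gt n t with hn | hn
  · exact .inl (List.prefix_nil.1 (hnil ▸ queries_prefix_of_le hn))
  · obtain ⟨l, hl⟩ := queries_prefix_of_le (M := M) (O := O) (x := x) (Nat.succ_le_of_lt hn)
    exact .inr ⟨l, by simpa [queries_succ, hnil, ho] using hl.symm⟩

theorem cons_sublist_of_nodup {o : Fin 2} {l : List (Fin 2)} (h : (o :: l).Nodup) :
    (o :: l).Sublist [o, Equiv.swap 0 1 o] := by
  obtain ⟨ho, hl⟩ := List.nodup_cons.1 h
  have hmem : ∀ a ∈ l, a = Equiv.swap 0 1 o := by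
    intro a ha
    have hao : a ≠ o := fun hao => ho (hao ▸ ha)
    clear h ho ha
    revert a o
    decide
  rw [List.eq_replicate_of_mem hmem] at hl ⊢
  exact List.Sublist.cons_cons o
    (List.replicate_sublist_replicate _ |>.2 (List.nodup_replicate.1 hl))

theorem OnceEachQueries.sublist (h : M.OnceEachQueries O) {o : Fin 2}
    (ho : M.FirstQueryTo O x o) (n : ℕ) :
    (M.queries O x n).Sublist [o, Equiv.swap 0 1 o] := by
  rcases ho.queries_eq_nil_or_cons n with hq | ⟨l, hq⟩
  · rw [hq]
    exact List.nil_sublist _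
  · rw [hq]
    exact cons_sublist_of_nodup (hq ▸ List.nodup_iff_count_le_one.2 (h x n))

end Queries

section Simulation

variable (N K : OracleTM) (O O' : Fin 2 → Language Bool) (x : List Bool)
  (σ : Fin 2 → Fin 2) (k : ℕ)

/-- On input `x`, the relation `R` is a simulation of `K` with the oracles `O'` by `N` with the
oracles `O`: each step of `K` is carried out by `k` steps of `N`, and a query of `K` to oracle `o`
becomes a query of `N` to oracle `σ o`. -/
structure IsSimulation (R : N.Cfg → K.Cfg → Prop) : Prop where
  step {c : N.Cfg} {c' : K.Cfg} : R c c' → R ((N.step O x)^[k] c) (K.step O' x c')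
  queriesFrom {c : N.Cfg} {c' : K.Cfg} :
    R c c' → N.queriesFrom O x c k = (K.asked x c').toList.map σ
  halt_iff {c : N.Cfg} {c' : K.Cfg} :
    R c c' → ∀ acc, N.instr x c = .halt acc ↔ K.instr x c' = .halt acc

/-- On input `x`, the machine `N` with the oracles `O` has the outcome of `K` with the oracles
`O'`, makes no further queries (up to the renaming `σ` of oracles), and takes `T` steps more than
`k` times as long. -/
structure Mimics (T : ℕ) : Prop where
  mem_accepts_iff : x ∈ N.accepts O ↔ x ∈ K.accepts O'
  queries_sublist (n : ℕ) : (N.queries O x n).Sublist ((K.queries O' x n).map σ)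
  haltsIn {n : ℕ} : K.HaltsIn O' x n → N.HaltsIn O x (T + k * n)

variable {N K O O' x σ k} {R : N.Cfg → K.Cfg → Prop} {T : ℕ}

namespace IsSimulation

theorem run (hR : IsSimulation N K O O' x σ k R) (hT : R (N.run O x T) K.init) (n : ℕ) :
    R (N.run O x (T + k * n)) (K.run O' x n) := by
  induction n with
  | zero => exact hT
  | succ n ih =>
    rw [Nat.mul_succ, ← add_assoc, run_add, run_succ]
    exact hR.step ih

theorem queries (hR : IsSimulation N K O O' x σ k R) (hT : R (N.run O x T) K.init)
    (hq : N.queries O x T = []) (n : ℕ) :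
    N.queries O x (T + k * n) = (K.queries O' x n).map σ := by
  induction n with
  | zero => exact hq
  | succ n ih =>
    rw [Nat.mul_succ, ← add_assoc, queries_add, ih, hR.queriesFrom (hR.run hT n), queries_succ,
      List.map_append]

theorem mimics (hR : IsSimulation N K O O' x σ k R) (hk : 0 < k)
    (hT : R (N.run O x T) K.init) (hq : N.queries O x T = []) :
    Mimics N K O O' x σ k T := by
  have hle (n : ℕ) : n ≤ T + k * n := (Nat.le_mul_of_pos_left n hk).trans (Nat.le_add_left _ _)
  have hiff (n : ℕ) (acc : Bool) := hR.halt_iff (hR.run hT n) acc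
  refine ⟨⟨?_, ?_⟩, fun n => ?_, ?_⟩
  · rintro ⟨n, hn⟩
    exact ⟨n, (hiff n true).1 (by rw [run_eq_of_le hn (hle n), hn])⟩
  · rintro ⟨n, hn⟩
    exact ⟨_, (hiff n true).2 hn⟩
  · rw [← hR.queries hT hq]
    exact (queries_prefix_of_le (hle n)).sublist
  · rintro n ⟨acc, hacc⟩
    exact ⟨acc, (hiff n acc).2 hacc⟩

end IsSimulation

end Simulation

section Relay

variable (M : OracleTM) (σ : Fin 2 → Fin 2) (b : Option Bool)

/-- The machine that does what `M` does but passes every question `w` of `M` to oracle `o` on to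
oracle `σ o` as the question `w ++ b.toList`. Each step of `M` takes two steps, distinguished by
the Boolean in the state, because `b` has to be written after all bits that `M` has written. -/
def relay : OracleTM where
  State := M.State × Bool
  TapeIdx := M.TapeIdx
  Sym := M.Sym
  start := (M.start, false)
  trans q s v := match q.2, M.trans q.1 s v with
    | _, .halt acc => .halt acc
    | false, .work _ _ _ _ _ => .work (q.1, true) none v (fun _ => none) none
    | false, .ask _ _ _ => .work (q.1, true) none v (fun _ => none) b
    | true, .work q' inp w d m => .work (q', false) inp w d m
    | true, .ask o yes no => .ask (σ o) (yes, false) (no, false)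

/-- The oracles that `M` has access to when `M.relay σ b` has access to the oracles `O`. -/
def relayedOracles (O : Fin 2 → Language Bool) : Fin 2 → Language Bool :=
  fun o => {w | w ++ b.toList ∈ O (σ o)}

/-- The configuration of `M.relay σ b` in its first (`half = false`) or second (`half = true`)
step for the step of `M` from configuration `c`. -/
def relayCfg (half : Bool) (c : M.Cfg) : (M.relay σ b).Cfg where
  state := (c.state, half)
  pos := c.pos
  tapes := c.tapes
  query := c.query

variable {M σ b} {O : Fin 2 → Language Bool} {x : List Bool}

theorem instr_relayCfg (half : Bool) (c : M.Cfg) :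
    (M.relay σ b).instr x (relayCfg M σ b half c) =
      match half, M.instr x c with
      | _, .halt acc => .halt acc
      | false, .work _ _ _ _ _ =>
        .work (c.state, true) none (fun i => (c.tapes i).head) (fun _ => none) none
      | false, .ask _ _ _ =>
        .work (c.state, true) none (fun i => (c.tapes i).head) (fun _ => none) b
      | true, .work q inp w d m => .work (q, false) inp w d m
      | true, .ask o yes no => .ask (σ o) (yes, false) (no, false) :=
  rfl

theorem instr_update_query (c : M.Cfg) (w : List Bool) :
    M.instr x { c with query := w } = M.instr x c :=
  rfl

theorem step_relayCfg_false {c : M.Cfg} {m : Option Bool}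
    (h : (M.relay σ b).instr x (relayCfg M σ b false c) =
      .work (c.state, true) none (fun i => (c.tapes i).head) (fun _ => none) m) :
    (M.relay σ b).step O x (relayCfg M σ b false c) =
      relayCfg M σ b true { c with query := c.query ++ m.toList } := by
  rw [step_of_instr_eq_work h]
  rfl

open Classical in
theorem iterate_step_relayCfg (c : M.Cfg) :
    ((M.relay σ b).step O x)^[2] (relayCfg M σ b false c) =
      relayCfg M σ b false (M.step (relayedOracles σ b O) x c) := by
  rw [Function.iterate_succ_apply, Function.iterate_one]
  cases h : M.instr x c with
  | work q inp w d m =>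
    have hsecond : (M.relay σ b).instr x (relayCfg M σ b true { c with query := c.query ++ [] }) =
        .work (q, false) inp w d m := by
      rw [instr_relayCfg, instr_update_query, h]
    rw [step_relayCfg_false (m := none) (by rw [instr_relayCfg, h]), Option.toList_none,
      step_of_instr_eq_work hsecond, step_of_instr_eq_work h]
    simp only [relayCfg, List.append_nil]
    rfl
  | ask o yes no =>
    have hsecond : (M.relay σ b).instr x
        (relayCfg M σ b true { c with query := c.query ++ b.toList }) =
          .ask (σ o) (yes, false) (no, false) := by
      rw [instr_relayCfg, instr_update_query, h]
    rw [step_relayCfg_false (m := b) (by rw [instr_relayCfg, h]), step_of_instr_eq_ask hsecond,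
      step_of_instr_eq_ask h]
    simp only [relayCfg, relayedOracles]
    congr 1
    exact (apply_ite (·, false) _ _ _).symm
  | halt acc =>
    have hr : (M.relay σ b).instr x (relayCfg M σ b false c) = .halt acc := by
      rw [instr_relayCfg, h]
    rw [step_of_instr_eq_halt hr, step_of_instr_eq_halt hr, step_of_instr_eq_halt h]

theorem queriesFrom_relayCfg (c : M.Cfg) :
    (M.relay σ b).queriesFrom O x (relayCfg M σ b false c) 2 = (M.asked x c).toList.map σ := by
  have hfirst : (M.relay σ b).asked x (relayCfg M σ b false c) = none := by
    rw [asked, instr_relayCfg]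
    cases M.instr x c <;> rfl
  have hsecond : (M.relay σ b).asked x ((M.relay σ b).step O x (relayCfg M σ b false c)) =
      (M.asked x c).map σ := by
    cases h : M.instr x c with
    | work q inp w d m =>
      rw [step_relayCfg_false (m := none) (by rw [instr_relayCfg, h]), asked, asked,
        instr_relayCfg, instr_update_query, h]
      rfl
    | ask o yes no =>
      rw [step_relayCfg_false (m := b) (by rw [instr_relayCfg, h]), asked, asked,
        instr_relayCfg, instr_update_query, h]
      rfl
    | halt acc =>
      rw [step_of_instr_eq_halt (by rw [instr_relayCfg, h]), hfirst, asked, h]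
      rfl
  rw [queriesFrom_add _ 1 1, queriesFrom_one, queriesFrom_one, hfirst,
    Function.iterate_one, hsecond]
  cases M.asked x c <;> rfl

theorem relay_isSimulation :
    IsSimulation (M.relay σ b) M O (relayedOracles σ b O) x σ 2
      fun c c' => c = relayCfg M σ b false c' where
  step := by
    rintro _ c rfl
    exact iterate_step_relayCfg c
  queriesFrom := by
    rintro _ c rfl
    exact queriesFrom_relayCfg c
  halt_iff := by
    rintro _ c rfl acc
    rw [instr_relayCfg]
    cases M.instr x c <;> simp

theorem relay_mimics : Mimics (M.relay σ b) M O (relayedOracles σ b O) x σ 2 0 :=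
  relay_isSimulation.mimics two_pos rfl rfl

theorem IsPolyTime.relay (h : M.IsPolyTime) : (M.relay σ b).IsPolyTime := by
  obtain ⟨p, hp⟩ := h
  refine ⟨2 * p, fun O x => ?_⟩
  simpa only [Polynomial.eval_mul, Polynomial.eval_ofNat, zero_add] using
    relay_mimics.haltsIn (hp (relayedOracles σ b O) x)

end Relay

section Embedding

/-- A way of running `K` as a part of a machine with states `Q`, work tapes `ι` and alphabet `Γ`. -/
structure Embedding (K : OracleTM) (Q ι Γ : Type) [Inhabited Γ] where
  state : K.State → Q
  tape : K.TapeIdx → ι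
  tape_injective : Function.Injective tape
  encode : K.Sym → Γ
  /-- The blank symbol must be decoded as the blank symbol, so that blank tapes are. -/
  decode : Turing.PointedMap Γ K.Sym
  decode_encode : Function.LeftInverse decode encode

namespace Embedding

variable {K : OracleTM} {Q ι Γ : Type} [Inhabited Γ] (e : Embedding K Q ι Γ)

/-- The symbols that `K` sees when the symbols `v` are under the work-tape heads of the host. -/
def view (v : ι → Γ) (i : K.TapeIdx) : K.Sym :=
  e.decode (v (e.tape i))

/-- The instruction of the host that has the effect of an instruction of `K`. On the tapes that do
not belong to `K` it erases the scanned symbol. -/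
noncomputable def lift : Instr K.State K.TapeIdx K.Sym → Instr Q ι Γ
  | .work q inp w d m => .work (e.state q) inp
      (Function.extend e.tape (e.encode ∘ w) fun _ => default)
      (Function.extend e.tape d fun _ => none) m
  | .ask o yes no => .ask o (e.state yes) (e.state no)
  | .halt acc => .halt acc

end Embedding

variable {K N : OracleTM} (e : Embedding K N.State N.TapeIdx N.Sym)

/-- A configuration of the host `N` represents a configuration of `K`, except for the contents of
the query tape. -/
structure Embedding.Represents (c : N.Cfg) (c' : K.Cfg) : Prop where
  state : c.state = e.state c'.state
  pos : c.pos = c'.pos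
  tapes (i : K.TapeIdx) : (c.tapes (e.tape i)).map e.decode = c'.tapes i

namespace Embedding.Represents

variable {e} {O O' : Fin 2 → Language Bool} {x : List Bool} {c : N.Cfg} {c' : K.Cfg}

theorem view_heads (hc : e.Represents c c') :
    e.view (fun i => (c.tapes i).head) = fun i => (c'.tapes i).head := by
  funext i
  rw [view, ← hc.tapes, Turing.Tape.map_fst]

theorem step_of_work (hc : e.Represents c c') {q : K.State} {inp : Option Turing.Dir}
    {w : K.TapeIdx → K.Sym} {d : K.TapeIdx → Option Turing.Dir} {m m' : Option Bool}
    (h : N.instr x c = e.lift (.work q inp w d m)) (h' : K.instr x c' = .work q inp w d m') :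
    e.Represents (N.step O x c) (K.step O' x c') := by
  rw [step_of_instr_eq_work h, step_of_instr_eq_work h']
  refine ⟨rfl, by rw [hc.pos], fun i => ?_⟩
  simp only [e.tape_injective.extend_apply, Function.comp_apply, map_moveTape,
    Turing.Tape.map_write, e.decode_encode (w i), hc.tapes]

open Classical in
theorem step_of_ask (hc : e.Represents c c') (hq : c.query = c'.query) {o : Fin 2}
    {yes no : K.State} (h : N.instr x c = e.lift (.ask o yes no))
    (h' : K.instr x c' = .ask o yes no) :
    e.Represents (N.step O x c) (K.step O x c') := by
  rw [step_of_instr_eq_ask h, step_of_instr_eq_ask h', hq]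
  exact ⟨(apply_ite e.state _ _ _).symm, hc.pos, hc.tapes⟩

end Embedding.Represents

/-- A configuration of the host `N` represents a configuration of `K`, including the contents of
the query tape. -/
structure Embedding.FullyRepresents (c : N.Cfg) (c' : K.Cfg) : Prop
    extends e.Represents c c' where
  query : c.query = c'.query

variable {e}

theorem Embedding.FullyRepresents.step {O : Fin 2 → Language Bool} {x : List Bool} {c : N.Cfg}
    {c' : K.Cfg} (hc : e.FullyRepresents c c') (h : N.instr x c = e.lift (K.instr x c')) :
    e.FullyRepresents (N.step O x c) (K.step O x c') := by
  cases h' : K.instr x c' with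
  | work q inp w d m =>
    rw [h'] at h
    refine ⟨hc.step_of_work h h', ?_⟩
    rw [step_of_instr_eq_work h, step_of_instr_eq_work h', hc.query]
  | ask o yes no =>
    rw [h'] at h
    refine ⟨hc.step_of_ask hc.query h h', ?_⟩
    rw [step_of_instr_eq_ask h, step_of_instr_eq_ask h']
  | halt acc =>
    rw [h'] at h
    rwa [step_of_instr_eq_halt h, step_of_instr_eq_halt h']

theorem Embedding.isSimulation {O : Fin 2 → Language Bool} {x : List Bool}
    (h : ∀ q s v, N.trans (e.state q) s v = e.lift (K.trans q s (e.view v))) :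
    IsSimulation N K O O x id 1 e.FullyRepresents := by
  have hinstr {c : N.Cfg} {c' : K.Cfg} (hc : e.FullyRepresents c c') :
      N.instr x c = e.lift (K.instr x c') := by
    rw [instr, instr, hc.state, hc.pos, h, hc.view_heads]
  refine ⟨fun hc => hc.step (hinstr hc), fun {c c'} hc => ?_, fun {c c'} hc acc => ?_⟩
  · rw [queriesFrom_one, List.map_id, asked, asked, hinstr hc]
    cases K.instr x c' <;> rfl
  · rw [hinstr hc]
    cases K.instr x c' <;> simp [Embedding.lift]

end Embedding

section Dispatch

variable (M : OracleTM) (K : Fin 2 → OracleTM)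

/-- The states of `M.dispatch K`: first it probes for the first query of `M`, then it rewinds the
input tape, and then it runs the machine `K o`. -/
inductive DispatchState : Type
  | probe (q : M.State)
  | rewind (o : Fin 2)
  | run (o : Fin 2) (q : (K o).State)

instance : Finite (DispatchState M K) := by
  let f : M.State ⊕ Fin 2 ⊕ (Σ o, (K o).State) → DispatchState M K :=
    Sum.elim .probe (Sum.elim .rewind fun q => .run q.1 q.2)
  refine Finite.of_surjective f ?_
  rintro (q | o | ⟨o, q⟩)
  exacts [⟨.inl q, rfl⟩, ⟨.inr (.inl o), rfl⟩, ⟨.inr (.inr ⟨o, q⟩), rfl⟩]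

/-- `M` as a part of `M.dispatch K`. -/
def probeEmbedding : Embedding M (DispatchState M K) (M.TapeIdx ⊕ Σ o, (K o).TapeIdx)
    (M.Sym × ∀ o, (K o).Sym) where
  state := .probe
  tape := .inl
  tape_injective := Sum.inl_injective
  encode a := (a, default)
  decode := ⟨Prod.fst, rfl⟩
  decode_encode _ := rfl

/-- `K o` as a part of `M.dispatch K`. -/
def runEmbedding (o : Fin 2) : Embedding (K o) (DispatchState M K)
    (M.TapeIdx ⊕ Σ o, (K o).TapeIdx) (M.Sym × ∀ o, (K o).Sym) where
  state := .run o
  tape i := .inr ⟨o, i⟩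
  tape_injective := Sum.inr_injective.comp sigma_mk_injective
  encode a := (default, Function.update default o a)
  decode := ⟨fun a => a.2 o, rfl⟩
  decode_encode a := Function.update_self o a (default : ∀ o, (K o).Sym)

/-- The machine that runs `M` without ever asking a question: as soon as `M` is about to query
oracle `o`, the input tape is rewound and `K o` is run. -/
noncomputable def dispatch : OracleTM where
  State := DispatchState M K
  TapeIdx := M.TapeIdx ⊕ Σ o, (K o).TapeIdx
  Sym := M.Sym × ∀ o, (K o).Sym
  start := .probe M.start
  trans
    | .probe q, s, v => match M.trans q s ((probeEmbedding M K).view v) with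
      | .work q inp w d _ => (probeEmbedding M K).lift (.work q inp w d none)
      | .ask o _ _ => .work (.rewind o) none (fun _ => default) (fun _ => none) none
      | .halt acc => .halt acc
    | .rewind o, .left, _ =>
      .work (.run o (K o).start) none (fun _ => default) (fun _ => none) none
    | .rewind o, _, _ =>
      .work (.rewind o) (some .left) (fun _ => default) (fun _ => none) none
    | .run o q, s, v => (runEmbedding M K o).lift ((K o).trans q s ((runEmbedding M K o).view v))

variable {M K} {O O' : Fin 2 → Language Bool} {x : List Bool}

/-- The work tapes of the machines `K o` are blank and so is the query tape. -/
structure IsFresh (c : (M.dispatch K).Cfg) : Prop where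
  tapes (i : Σ o, (K o).TapeIdx) : c.tapes (.inr i) = default
  query : c.query = []

/-- `M.dispatch K` in configuration `c` probes `M` in configuration `c'`. -/
structure Probing (c : (M.dispatch K).Cfg) (c' : M.Cfg) : Prop extends IsFresh c where
  represents : Embedding.Represents (N := M.dispatch K) (probeEmbedding M K) c c'

/-- `M.dispatch K` is about to run `K o` and rewinds the input tape with the head at `p`. -/
structure Rewinding (o : Fin 2) (p : ℕ) (c : (M.dispatch K).Cfg) : Prop extends IsFresh c where
  state : c.state = .rewind o
  pos : c.pos = p

theorem IsFresh.step_of_work {c : (M.dispatch K).Cfg} (hc : IsFresh c)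
    {q : (M.dispatch K).State} {inp : Option Turing.Dir}
    {w : (M.dispatch K).TapeIdx → (M.dispatch K).Sym}
    {d : (M.dispatch K).TapeIdx → Option Turing.Dir}
    (h : (M.dispatch K).instr x c = .work q inp w d none)
    (hw : ∀ i, w (.inr i) = default) (hd : ∀ i, d (.inr i) = none) :
    IsFresh ((M.dispatch K).step O x c) := by
  rw [step_of_instr_eq_work h]
  refine ⟨fun i => ?_, by rw [hc.query]; rfl⟩
  change moveTape (d (.inr i)) ((c.tapes (.inr i)).write (w (.inr i))) = default
  rw [hw, hd, hc.tapes]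
  exact moveTape_none_write_default

theorem probing_init : Probing (M.dispatch K).init M.init :=
  ⟨⟨fun _ => rfl, rfl⟩, ⟨rfl, rfl, fun _ => map_default_tape _⟩⟩

namespace Probing

variable {c : (M.dispatch K).Cfg} {c' : M.Cfg}

theorem instr_eq (hc : Probing c c') :
    (M.dispatch K).instr x c = match M.instr x c' with
      | .work q inp w d _ => (probeEmbedding M K).lift (.work q inp w d none)
      | .ask o _ _ => .work (.rewind o) none (fun _ => default) (fun _ => none) none
      | .halt acc => .halt acc := by
  rw [instr, instr, hc.represents.state, hc.represents.pos, ← hc.represents.view_heads]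
  rfl

theorem asked_eq_none (hc : Probing c c') : (M.dispatch K).asked x c = none := by
  rw [asked, hc.instr_eq]
  cases M.instr x c' <;> rfl

theorem halt_iff (hc : Probing c c') (acc : Bool) :
    (M.dispatch K).instr x c = .halt acc ↔ M.instr x c' = .halt acc := by
  rw [hc.instr_eq]
  cases M.instr x c' <;> simp [Embedding.lift]

theorem step (hc : Probing c c') (h : M.asked x c' = none) :
    Probing ((M.dispatch K).step O x c) (M.step O' x c') := by
  have hi := hc.instr_eq (x := x)
  cases h' : M.instr x c' with
  | work q inp w d m =>
    rw [h'] at hi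
    refine ⟨hc.toIsFresh.step_of_work hi (fun i => ?_) fun i => ?_,
      hc.represents.step_of_work hi h'⟩ <;>
    exact Function.extend_apply' _ _ _ fun ⟨_, hj⟩ => Sum.inl_ne_inr hj
  | ask o yes no => simp [asked, h'] at h
  | halt acc =>
    rw [h'] at hi
    rwa [step_of_instr_eq_halt hi, step_of_instr_eq_halt h']

theorem rewinding_step (hc : Probing c c') {o : Fin 2} (h : M.asked x c' = some o) :
    Rewinding o c'.pos ((M.dispatch K).step O x c) := by
  have hi := hc.instr_eq (x := x)
  cases h' : M.instr x c' with
  | ask o' yes no =>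
    obtain rfl : o' = o := by simpa [asked, h'] using h
    rw [h'] at hi
    refine ⟨hc.toIsFresh.step_of_work hi (fun _ => rfl) fun _ => rfl, ?_, ?_⟩ <;>
      rw [step_of_instr_eq_work hi]
    exact hc.represents.pos
  | work | halt => simp [asked, h'] at h

end Probing

theorem probing_run {n : ℕ} (h : M.queries O' x n = []) :
    Probing ((M.dispatch K).run O x n) (M.run O' x n) ∧ (M.dispatch K).queries O x n = [] := by
  induction n with
  | zero => exact ⟨probing_init, rfl⟩
  | succ n ih =>
    rw [queries_succ, List.append_eq_nil_iff, Option.toList_eq_nil_iff] at h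
    obtain ⟨hc, hq⟩ := ih h.1
    rw [run_succ, run_succ, queries_succ, hq, hc.asked_eq_none]
    exact ⟨hc.step h.2, rfl⟩

theorem dispatch_mimics_of_queries_eq_nil (h : ∀ n, M.queries O' x n = []) :
    Mimics (M.dispatch K) M O O' x id 1 0 := by
  have hnone := asked_eq_none_of_queries_eq_nil h
  have hR : IsSimulation (M.dispatch K) M O O' x id 1
      fun c c' => Probing c c' ∧ ∃ n, c' = M.run O' x n := by
    refine ⟨?_, ?_, fun hc => hc.1.halt_iff⟩
    · rintro c _ ⟨hc, n, rfl⟩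
      exact ⟨hc.step (hnone n), n + 1, (run_succ n).symm⟩
    · rintro c _ ⟨hc, n, rfl⟩
      rw [queriesFrom_one, hc.asked_eq_none, hnone]
      rfl
  exact hR.mimics one_pos ⟨probing_init, 0, rfl⟩ rfl

namespace Rewinding

variable {o : Fin 2} {c : (M.dispatch K).Cfg}

theorem instr_eq_of_succ {p : ℕ} (hc : Rewinding o (p + 1) c) :
    (M.dispatch K).instr x c =
      .work (.rewind o) (some .left) (fun _ => default) (fun _ => none) none := by
  rw [instr, hc.state, hc.pos, inputAt]
  cases x[p]? <;> rfl

theorem instr_eq_of_zero (hc : Rewinding o 0 c) :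
    (M.dispatch K).instr x c =
      .work (.run o (K o).start) none (fun _ => default) (fun _ => none) none := by
  rw [instr, hc.state, hc.pos]
  rfl

theorem asked_eq_none {p : ℕ} (hc : Rewinding o p c) : (M.dispatch K).asked x c = none := by
  cases p with
  | zero => rw [asked, hc.instr_eq_of_zero]
  | succ p => rw [asked, hc.instr_eq_of_succ]

theorem step {p : ℕ} (hc : Rewinding o (p + 1) c) :
    Rewinding o p ((M.dispatch K).step O x c) := by
  refine ⟨hc.toIsFresh.step_of_work hc.instr_eq_of_succ (fun _ => rfl) fun _ => rfl, ?_, ?_⟩ <;>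
    rw [step_of_instr_eq_work hc.instr_eq_of_succ]
  rw [hc.pos]
  rfl

theorem step_zero (hc : Rewinding o 0 c) :
    Embedding.FullyRepresents (N := M.dispatch K) (runEmbedding M K o)
      ((M.dispatch K).step O x c) (K o).init := by
  have hi := hc.instr_eq_of_zero (x := x)
  have hfresh : IsFresh ((M.dispatch K).step O x c) :=
    hc.toIsFresh.step_of_work hi (fun _ => rfl) fun _ => rfl
  refine ⟨⟨?_, ?_, fun i => ?_⟩, hfresh.query⟩
  · rw [step_of_instr_eq_work hi]
    rfl
  · rw [step_of_instr_eq_work hi]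
    exact hc.pos
  · exact (congrArg _ (hfresh.tapes ⟨o, i⟩)).trans (map_default_tape _)

theorem run {p t : ℕ} (hc : Rewinding o p ((M.dispatch K).run O x t))
    (hq : (M.dispatch K).queries O x t = []) :
    Embedding.FullyRepresents (N := M.dispatch K) (runEmbedding M K o)
        ((M.dispatch K).run O x (t + (p + 1))) (K o).init ∧
      (M.dispatch K).queries O x (t + (p + 1)) = [] := by
  induction p generalizing t with
  | zero =>
    rw [zero_add, run_succ, queries_succ, hq, hc.asked_eq_none]
    exact ⟨hc.step_zero, rfl⟩
  | succ p ih =>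
    rw [add_comm (p + 1), ← add_assoc]
    refine ih ?_ ?_
    · rw [run_succ]
      exact hc.step
    · rw [queries_succ, hq, hc.asked_eq_none]
      rfl

end Rewinding

theorem dispatch_mimics_of_firstQueryTo {o : Fin 2} (h : M.FirstQueryTo O' x o) {n : ℕ}
    (hn : M.HaltsIn O' x n) :
    ∃ T ≤ n + x.length + 2, Mimics (M.dispatch K) (K o) O O x id 1 T := by
  obtain ⟨t, hnil, ho⟩ := h
  obtain ⟨hc, hq⟩ := probing_run (K := K) (O := O) hnil
  have hrewind : Rewinding o (M.run O' x t).pos ((M.dispatch K).run O x (t + 1)) := by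
    rw [run_succ]
    exact hc.rewinding_step ho
  obtain ⟨hstart, hq'⟩ := hrewind.run (by rw [queries_succ, hq, hc.asked_eq_none]; rfl)
  have htn : t < n := hn.lt_of_asked_eq_some ho
  have hpos : (M.run O' x t).pos ≤ x.length + 1 := pos_run_le t
  refine ⟨t + 1 + ((M.run O' x t).pos + 1), by omega, ?_⟩
  exact (Embedding.isSimulation fun _ _ _ => rfl).mimics one_pos hstart hq'

theorem IsPolyTime.dispatch (hM : M.IsPolyTime) (hK : ∀ o, (K o).IsPolyTime) :
    (M.dispatch K).IsPolyTime := by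
  obtain ⟨p, hp⟩ := hM
  choose r hr using hK
  refine ⟨p + Polynomial.X + 2 + ∑ o, r o, fun O x => ?_⟩
  simp only [Polynomial.eval_add, Polynomial.eval_X, Polynomial.eval_ofNat,
    Polynomial.eval_finsetSum]
  rcases queries_eq_nil_or_firstQueryTo (M := M) (O := O) (x := x) with h | ⟨o, h⟩
  · exact ((dispatch_mimics_of_queries_eq_nil h).haltsIn (hp O x)).mono (by omega)
  · obtain ⟨T, hT, hmimics⟩ := dispatch_mimics_of_firstQueryTo (K := K) (O := O) h (hp O x)
    have hro : (r o).eval x.length ≤ ∑ o, (r o).eval x.length :=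
      Finset.single_le_sum (f := fun o => (r o).eval x.length) (fun _ _ => Nat.zero_le _)
        (Finset.mem_univ o)
    exact (hmimics.haltsIn (hr o O x)).mono (by omega)

theorem dispatch_orderedQueries (hM : M.IsPolyTime)
    (h : ∀ o x, M.FirstQueryTo O' x o → ∀ n, ((K o).queries O x n).Sublist [0, 1]) :
    (M.dispatch K).OrderedQueries O := by
  obtain ⟨p, hp⟩ := hM
  intro x n
  rcases queries_eq_nil_or_firstQueryTo (M := M) (O := O') (x := x) with hx | ⟨o, hx⟩
  · have hsub := (dispatch_mimics_of_queries_eq_nil (K := K) (O := O) hx).queries_sublist n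
    rw [hx n] at hsub
    exact hsub.trans (List.nil_sublist _)
  · obtain ⟨T, -, hmimics⟩ := dispatch_mimics_of_firstQueryTo (K := K) (O := O) hx (hp O' x)
    have hsub := hmimics.queries_sublist n
    rw [List.map_id] at hsub
    exact hsub.trans (h o x hx n)

theorem mem_accepts_dispatch_iff (hM : M.IsPolyTime) {o : Fin 2} (h : M.FirstQueryTo O' x o) :
    x ∈ (M.dispatch K).accepts O ↔ x ∈ (K o).accepts O := by
  obtain ⟨p, hp⟩ := hM
  obtain ⟨T, -, hmimics⟩ := dispatch_mimics_of_firstQueryTo (K := K) (O := O) h (hp O' x)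
  exact hmimics.mem_accepts_iff

end Dispatch

section Reject

/-- The machine that rejects at once. -/
def reject : OracleTM where
  State := Unit
  TapeIdx := Empty
  Sym := Unit
  start := ()
  trans _ _ _ := .halt false

theorem reject_isPolyTime : reject.IsPolyTime :=
  ⟨0, fun _ _ => ⟨false, rfl⟩⟩

theorem reject_queries (O : Fin 2 → Language Bool) (x : List Bool) (n : ℕ) :
    reject.queries O x n = [] :=
  List.filterMap_eq_nil_iff.2 fun _ _ => rfl

end Reject

end OracleTM

open OracleTM

section Oracles

theorem append_false_mem_disjointUnion {A B : Language Bool} {w : List Bool} :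
    w ++ [false] ∈ disjointUnion A B ↔ w ∈ A := by
  change ((∃ y ∈ A, w ++ [false] = y ++ [false]) ∨ ∃ y ∈ B, w ++ [false] = y ++ [true]) ↔ w ∈ A
  simp

theorem append_true_mem_disjointUnion {A B : Language Bool} {w : List Bool} :
    w ++ [true] ∈ disjointUnion A B ↔ w ∈ B := by
  change ((∃ y ∈ A, w ++ [true] = y ++ [false]) ∨ ∃ y ∈ B, w ++ [true] = y ++ [true]) ↔ w ∈ B
  simp

variable (A A' B B' : Language Bool)

theorem relayedOracles_false_disjointUnion :
    relayedOracles id (some false) ![disjointUnion A A', disjointUnion B B'] = ![A, B] := by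
  funext o
  fin_cases o <;> exact Set.ext fun w => append_false_mem_disjointUnion

theorem relayedOracles_true_disjointUnion :
    relayedOracles id (some true) ![disjointUnion A A', disjointUnion B B'] = ![A', B'] := by
  funext o
  fin_cases o <;> exact Set.ext fun w => append_true_mem_disjointUnion

theorem relayedOracles_swap : relayedOracles (Equiv.swap 0 1) none ![B, A] = ![A, B] := by
  funext o
  simp only [relayedOracles, Option.toList_none, List.append_nil]
  fin_cases o <;> rfl

end Oracles

section Classes

variable {C D : Set (Language Bool)} {A B : Language Bool} {M : OracleTM}

theorem POrdered_subset_PAnyOrder (C D : Set (Language Bool)) :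
    POrdered C D ⊆ PAnyOrder C D := by
  rintro L ⟨A, hA, B, hB, M, hM, hq, rfl⟩
  have hcount : ∀ o : Fin 2, [0, 1].count o ≤ 1 := by decide
  exact ⟨A, hA, B, hB, M, hM, fun x n o => ((hq x n).count_le o).trans (hcount o), rfl⟩

theorem exists_mem_POrdered_of_firstQueryTo_one (hA : A ∈ C) (hB : B ∈ D) (hM : M.IsPolyTime)
    (hq : M.OnceEachQueries ![A, B]) :
    ∃ L ∈ POrdered D C, ∀ x, M.FirstQueryTo ![A, B] x 1 →
      (x ∈ L ↔ x ∈ M.accepts ![A, B]) := by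
  let K : Fin 2 → OracleTM := ![reject, M.relay (Equiv.swap 0 1) none]
  have hK : ∀ o, (K o).IsPolyTime := Fin.forall_fin_two.2 ⟨reject_isPolyTime, hM.relay⟩
  have hmimics (x : List Bool) :
      Mimics (K 1) M ![B, A] ![A, B] x (Equiv.swap 0 1) 2 0 := by
    rw [← relayedOracles_swap A B]
    exact relay_mimics
  refine ⟨(M.dispatch K).accepts ![B, A], ⟨B, hB, A, hA, M.dispatch K, hM.dispatch hK,
    dispatch_orderedQueries (O' := ![A, B]) hM (Fin.forall_fin_two.2 ⟨?_, ?_⟩), rfl⟩, ?_⟩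
  · intro x _ n
    exact (reject_queries ![B, A] x n).symm ▸ List.nil_sublist _
  · intro x hx n
    exact ((hmimics x).queries_sublist n).trans ((hq.sublist hx n).map _)
  · intro x hx
    rw [mem_accepts_dispatch_iff hM hx, (hmimics x).mem_accepts_iff]

theorem accepts_mem_POrdered {A' B' : Language Bool} {M' : OracleTM}
    (hA : disjointUnion A A' ∈ C) (hB : disjointUnion B B' ∈ D) (hM : M.IsPolyTime)
    (hq : M.OnceEachQueries ![A, B]) (hM' : M'.IsPolyTime) (hq' : M'.OrderedQueries ![A', B'])
    (hagree : ∀ x, M.FirstQueryTo ![A, B] x 1 →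
      (x ∈ M'.accepts ![A', B'] ↔ x ∈ M.accepts ![A, B])) :
    M.accepts ![A, B] ∈ POrdered C D := by
  let O : Fin 2 → Language Bool := ![disjointUnion A A', disjointUnion B B']
  let K : Fin 2 → OracleTM := ![M.relay id (some false), M'.relay id (some true)]
  have hK : ∀ o, (K o).IsPolyTime := Fin.forall_fin_two.2 ⟨hM.relay, hM'.relay⟩
  have hzero (x : List Bool) : Mimics (K 0) M O ![A, B] x id 2 0 := by
    rw [← relayedOracles_false_disjointUnion A A' B B']
    exact relay_mimics
  have hone (x : List Bool) : Mimics (K 1) M' O ![A', B'] x id 2 0 := by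
    rw [← relayedOracles_true_disjointUnion A A' B B']
    exact relay_mimics
  refine ⟨_, hA, _, hB, M.dispatch K, hM.dispatch hK,
    dispatch_orderedQueries (O' := ![A, B]) hM (Fin.forall_fin_two.2 ⟨?_, ?_⟩), ?_⟩
  · intro x hx n
    exact ((hzero x).queries_sublist n).trans (by simpa using hq.sublist hx n)
  · intro x _ n
    exact ((hone x).queries_sublist n).trans (by simpa using hq' x n)
  · ext x
    rcases queries_eq_nil_or_firstQueryTo (M := M) (O := ![A, B]) (x := x) with hx | ⟨o, hx⟩
    · exact (dispatch_mimics_of_queries_eq_nil hx).mem_accepts_iff.symm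
    · rw [mem_accepts_dispatch_iff hM hx]
      fin_cases o
      · exact (hzero x).mem_accepts_iff.symm
      · exact ((hone x).mem_accepts_iff.trans (hagree x hx)).symm

end Classes

end QueryOrder

open QueryOrder

theorem theoremt_general (C D : Set (Language Bool)) (hC : ClosedUnderDisjointUnion C)
    (hD : ClosedUnderDisjointUnion D) (h : POrdered D C ⊆ POrdered C D) :
    POrdered C D = PAnyOrder C D := by
  refine (POrdered_subset_PAnyOrder C D).antisymm ?_
  rintro _ ⟨A, hA, B, hB, M, hM, hq, rfl⟩
  obtain ⟨L, hL, hagree⟩ := exists_mem_POrdered_of_firstQueryTo_one hA hB hM hq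
  obtain ⟨A', hA', B', hB', M', hM', hq', rfl⟩ := h hL
  exact accepts_mem_POrdered (hC A hA A' hA') (hD B hB B' hB') hM hq hM' hq' hagree

theorem theoremt (C D : Set (Language Bool))
    (hC : QueryOrder.ClosedUnderDisjointUnion C) (hD : QueryOrder.ClosedUnderDisjointUnion D)
    (h : QueryOrder.POrdered C D = QueryOrder.POrdered D C) :
    QueryOrder.POrdered C D = QueryOrder.PAnyOrder C D :=
  theoremt_general C D hC hD h.ge
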